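/- Let $R$ be a commutative Noetherian local ring and let $C$ be a semidualizing $R$-module, i.e. a finitely generated $R$-module such that the homothety map $R\to\operatorname{Hom}_R(C,C)$ is an isomorphism and $\operatorname{Ext}^i_R(C,C)=0$ for all $i>0$. For a complex $X=(\cdots\to X_{i+1}\to X_i\to X_{i-1}\to\cdots)$ of $R$-modules put $\inf X=\inf\{i\in\mathbb Z\mid X_i\neq 0\}$ and $\operatorname{hinf}X=\inf\{i\in\mathbb Z\mid \operatorname{H}_i(X)\neq 0\}$. A $C$-quasi-injective resolution of an $R$-module $M$ is a bounded complex $I$ of injective $R$-modules such that $\operatorname{Hom}_R(C,I)$ is not acyclic and each homology module $\operatorname{H}_i(\operatorname{Hom}_R(C,I))$ is isomorphic to a finite (possibly empty) direct sum of copies of $M$. The $C$-quasi-injective dimension of $M\neq 0$ is $$C\text{-}\operatorname{qid}_R M=\inf\{\operatorname{hinf}\operatorname{Hom}_R(C,I)-\inf\operatorname{Hom}_R(C,I)\mid I\text{ is a }C\text{-quasi-injective resolution of }M\},$$ which is $\infty$ if $M$ has no $C$-quasi-injective resolution; for $M=0$ it is $-\infty$. **Theorem.** Let $M$ be a nonzero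 finitely generated $R$-module with $C\text{-}\operatorname{qid}_R M<\infty$. Assume that $R$ is Cohen–Macaulay or that $\operatorname{Tor}^R_i(C,M)=0$ for all $i>0$. Then $$C\text{-}\operatorname{qid}_R M=\operatorname{depth}R.$$ -/

import Mathlib

open CategoryTheory Limits
open scoped ENNReal

universe u

noncomputable section

/-- A finitely generated module `C` over a commutative ring `R` is semidualizing if the homothety
map `R → Hom_R(C, C)` is an isomorphism and `Ext^i_R(C, C) = 0` for all `i > 0`. -/
structure IsSemidualizing (R : Type u) [CommRing R] (C : Type u) [AddCommGroup C] [Module R C] :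
    Prop where
  finite : Module.Finite R C
  homothety_bijective : Function.Bijective (algebraMap R (Module.End R C))
  ext_eq_zero : ∀ i : ℕ, 0 < i →
    Subsingleton (Abelian.Ext (ModuleCat.of R C) (ModuleCat.of R C) i)

/-- `Tor_i^R(C, M) = 0` for all `i > 0`. -/
def TorPosVanishes (R : Type u) [CommRing R] (C M : Type u) [AddCommGroup C] [Module R C]
    [AddCommGroup M] [Module R M] : Prop :=
  ∀ i : ℕ, 0 < i →
    IsZero (((Tor (ModuleCat.{u} R) i).obj (ModuleCat.of R C)).obj (ModuleCat.of R M))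

namespace ChainComplex

variable {R : Type u} [CommRing R]

/-- `inf X = inf {i ∈ ℤ | X_i ≠ 0}`, with `inf ∅ = ∞`. -/
def lowerInf (X : ChainComplex (ModuleCat.{u} R) ℤ) : EReal :=
  ⨅ (i : ℤ) (_ : ¬ IsZero (X.X i)), ((i : ℝ) : EReal)

/-- `hinf X = inf {i ∈ ℤ | H_i(X) ≠ 0}`, with `inf ∅ = ∞`. -/
def homologicalInf (X : ChainComplex (ModuleCat.{u} R) ℤ) : EReal :=
  ⨅ (i : ℤ) (_ : ¬ IsZero (X.homology i)), ((i : ℝ) : EReal)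

/-- The complex `X` is bounded: `X_i = 0` for all `i` outside some interval `[a, b]`. -/
def IsBounded (X : ChainComplex (ModuleCat.{u} R) ℤ) : Prop :=
  ∃ a b : ℤ, ∀ i : ℤ, i < a ∨ b < i → IsZero (X.X i)

/-- The complex `Hom_R(C, X)`, obtained by applying `Hom_R(C, -)` in every degree. -/
def homFrom (C : Type u) [AddCommGroup C] [Module R C]
    (X : ChainComplex (ModuleCat.{u} R) ℤ) : ChainComplex (ModuleCat.{u} R) ℤ :=
  (((linearCoyoneda R (ModuleCat.{u} R)).obj
    (Opposite.op (ModuleCat.of R C))).mapHomologicalComplex (ComplexShape.down ℤ)).obj X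

end ChainComplex

/-- `I` is a `C`-quasi-injective resolution of `M`: a bounded complex of injective modules such
that `Hom_R(C, I)` is not acyclic and each of its homology modules is isomorphic to a finite
direct sum (possibly zero) of copies of `M`. -/
structure IsCQuasiInjectiveResolution {R : Type u} [CommRing R] (C M : Type u) [AddCommGroup C]
    [Module R C] [AddCommGroup M] [Module R M] (I : ChainComplex (ModuleCat.{u} R) ℤ) :
    Prop where
  isBounded : I.IsBounded
  injective : ∀ i : ℤ, Module.Injective R (I.X i)
  not_acyclic : ¬ (I.homFrom C).Acyclic
  homology_iso : ∀ i : ℤ, ∃ b : ℕ, Nonempty ((I.homFrom C).homology i ≃ₗ[R] (Fin b → M))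

open scoped Classical in
/-- The `C`-quasi-injective dimension of `M`: it is `-∞` if `M = 0`, and otherwise the infimum of
`hinf Hom_R(C, I) - inf Hom_R(C, I)` over all `C`-quasi-injective resolutions `I` of `M`; so it is
`∞` if there is no such resolution. -/
def cQuasiInjectiveDim (R : Type u) [CommRing R] (C M : Type u) [AddCommGroup C] [Module R C]
    [AddCommGroup M] [Module R M] : EReal :=
  if Subsingleton M then ⊥ else
    ⨅ (I : ChainComplex (ModuleCat.{u} R) ℤ) (_ : IsCQuasiInjectiveResolution C M I),
      (I.homFrom C).homologicalInf - (I.homFrom C).lowerInf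

/-- The depth of a local ring `R`: the supremum of the lengths of the `R`-regular sequences
contained in the maximal ideal. -/
def localRingDepth (R : Type u) [CommRing R] [IsLocalRing R] : ℕ∞ :=
  ⨆ (rs : List R) (_ : (∀ r ∈ rs, r ∈ IsLocalRing.maximalIdeal R) ∧
    RingTheory.Sequence.IsRegular R rs), (rs.length : ℕ∞)

/-- A Noetherian local ring is Cohen-Macaulay if its depth equals its Krull dimension. -/
structure IsCohenMacaulayLocalRing (R : Type u) [CommRing R] [IsLocalRing R] : Prop where
  isNoetherian : IsNoetherianRing R
  depth_eq_dim : (localRingDepth R : WithBot ℕ∞) = ringKrullDim R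

end

/-! ### The contravariant functors `H_j(Hom_R(-, I))` and their long exact sequences. -/

namespace ChainComplex

variable {R : Type u} [CommRing R] (I : ChainComplex (ModuleCat.{u} R) ℤ)
variable {A B D : Type u} [AddCommGroup A] [AddCommGroup B] [AddCommGroup D]
  [Module R A] [Module R B] [Module R D]

/-! Bass's argument for modules of finite injective dimension is run on a resolution `I`, with
`H_j(Hom_R(A, I))` in the role of `Ext^{-j}(A, I)`. Since the terms of `I` are injective, short
exact sequences in `A` give long exact sequences. Nakayama's lemma needs finitely generated
homology, which the resolution supplies only for `A = C`. Because `Hom_R(C, C) = R` and the higher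
`Ext(C, C)` vanish, dualizing free covers into `C` transfers finiteness from `C` to `R`, and then to
every finitely generated `A` (`isNoetherian_homology_of_isSemidualizing`).

Let `s` be the least degree with `H_s(Hom_R(C, I)) ≠ 0`. Killing a `C`-regular element lowers this
degree by exactly one (`homology_quotSMulTop`). Regular sequences on `C` and on `R` agree, so a
regular sequence of length `n` forces `I_{s-n} ≠ 0`, hence `Hom_R(C, I_{s-n}) ≠ 0`. This bounds the
depth by the dimension.

Conversely, for a maximal regular sequence `x` of length `n`, the residue field embeds in `C/xC`.
Vanishing of `H_i(Hom_R(C/xC, I))` below `d = s - n` then spreads to all finitely generated modules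
(`subsingleton_homology_of_depth_zero`). Consequently the cycles of `I` in degree `d` are injective,
and the truncation of `I` at `d` is a resolution attaining the value `n`. -/

lemma homologyMap_smul_id (K : ChainComplex (ModuleCat.{u} R) ℤ) (j : ℤ) (r : R) :
    HomologicalComplex.homologyMap (r • 𝟙 K) j = r • 𝟙 (K.homology j) := by
  have h : (HomologicalComplex.shortComplexFunctor (ModuleCat.{u} R) (ComplexShape.down ℤ) j).map
      (r • 𝟙 K) = r • 𝟙 (K.sc j) := by
    ext <;> rfl
  rw [HomologicalComplex.homologyMap, h, ShortComplex.homologyMap_smul,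
    ShortComplex.homologyMap_id]
  rfl

/-- Precomposition with `f : A → B`, as a chain map `Hom_R(B, I) → Hom_R(A, I)`. -/
noncomputable def homFromPrecomp (f : A →ₗ[R] B) : I.homFrom B ⟶ I.homFrom A :=
  (NatTrans.mapHomologicalComplex
    ((linearCoyoneda R (ModuleCat.{u} R)).map (ModuleCat.ofHom f).op) (ComplexShape.down ℤ)).app I

/-- The map induced by `f : A → B` on the homology of `Hom_R(-, I)`. -/
noncomputable def homologyPrecomp (j : ℤ) (f : A →ₗ[R] B) :
    (I.homFrom B).homology j →ₗ[R] (I.homFrom A).homology j :=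
  (HomologicalComplex.homologyMap (I.homFromPrecomp f) j).hom

/-- This identifies the first map in the long exact sequence of `x : A → A` with multiplication by
`x` on homology, which is the form Nakayama's lemma requires. -/
lemma homologyPrecomp_smul (j : ℤ) (r : R) (z : (I.homFrom A).homology j) :
    I.homologyPrecomp j (r • (LinearMap.id : A →ₗ[R] A)) z = r • z := by
  have h : I.homFromPrecomp (r • (LinearMap.id : A →ₗ[R] A)) = r • 𝟙 _ := by
    ext i x
    change ModuleCat.ofHom (r • (LinearMap.id : A →ₗ[R] A)) ≫ x = r • x
    ext a
    exact map_smul x.hom r a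
  rw [homologyPrecomp, h, homologyMap_smul_id]
  rfl

variable {I}

/-- Left exactness of Hom is automatic; injectivity of the terms of `I` enters only in extending
maps from `A` to `B`. -/
lemma homFromPrecomp_shortExact (hI : ∀ i, Module.Injective R (I.X i)) {f : A →ₗ[R] B}
    {g : B →ₗ[R] D} (hf : Function.Injective f) (hg : Function.Surjective g)
    (hfg : Function.Exact f g) :
    ∃ w : I.homFromPrecomp g ≫ I.homFromPrecomp f = 0,
      (ShortComplex.mk (I.homFromPrecomp g) (I.homFromPrecomp f) w).ShortExact := by
  have w : I.homFromPrecomp g ≫ I.homFromPrecomp f = 0 := by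
    ext i x
    change ModuleCat.ofHom f ≫ ModuleCat.ofHom g ≫ x = 0
    ext a
    change x.hom (g (f a)) = 0
    rw [hfg.apply_apply_eq_zero, map_zero]
  refine ⟨w, HomologicalComplex.shortExact_of_degreewise_shortExact _ fun i => ?_⟩
  refine ModuleCat.shortComplex_shortExact _ ?_ ?_ ?_
  · intro (x : ModuleCat.of R B ⟶ I.X i)
    change ModuleCat.ofHom f ≫ x = 0 ↔ ∃ y : ModuleCat.of R D ⟶ I.X i, ModuleCat.ofHom g ≫ y = x
    constructor
    · intro hx
      have hker : LinearMap.ker g ≤ LinearMap.ker x.hom := by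
        intro b hb
        obtain ⟨a, rfl⟩ := (hfg b).1 hb
        exact congrArg (fun φ => φ.hom a) hx
      refine ⟨ModuleCat.ofHom ((LinearMap.ker g).liftQ x.hom hker ∘ₗ
        (g.quotKerEquivOfSurjective hg).symm.toLinearMap), ?_⟩
      ext b
      have : (g.quotKerEquivOfSurjective hg).symm (g b) = (LinearMap.ker g).mkQ b := by
        rw [LinearEquiv.symm_apply_eq]; rfl
      change (LinearMap.ker g).liftQ x.hom hker ((g.quotKerEquivOfSurjective hg).symm (g b)) = _
      rw [this]; rfl
    · rintro ⟨y, rfl⟩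
      ext a
      change y.hom (g (f a)) = 0
      rw [hfg.apply_apply_eq_zero, map_zero]
  · intro (x : ModuleCat.of R D ⟶ I.X i) (y : ModuleCat.of R D ⟶ I.X i)
      (h : ModuleCat.ofHom g ≫ x = ModuleCat.ofHom g ≫ y)
    refine ModuleCat.hom_ext (LinearMap.ext fun d => ?_)
    obtain ⟨b, rfl⟩ := hg d
    exact congrArg (fun φ => φ.hom b) h
  · intro (x : ModuleCat.of R A ⟶ I.X i)
    obtain ⟨h, hh⟩ := (hI i).out f hf x.hom
    refine ⟨ModuleCat.ofHom h, ?_⟩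
    change ModuleCat.ofHom f ≫ ModuleCat.ofHom h = x
    ext a
    exact hh a

lemma homologyPrecomp_exact (hI : ∀ i, Module.Injective R (I.X i)) {f : A →ₗ[R] B}
    {g : B →ₗ[R] D} (hf : Function.Injective f) (hg : Function.Surjective g)
    (hfg : Function.Exact f g) (j : ℤ) :
    Function.Exact (I.homologyPrecomp j g) (I.homologyPrecomp j f) := by
  obtain ⟨w, hS⟩ := homFromPrecomp_shortExact hI hf hg hfg
  exact (ShortComplex.ShortExact.moduleCat_exact_iff_function_exact _).1 (hS.homology_exact₂ j)

/-- Differentials lower degree, so the connecting map goes from degree `j` for the submodule to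
degree `j - 1` for the quotient. All later inductions on degree rest on this shift. -/
lemma exists_connecting (hI : ∀ i, Module.Injective R (I.X i)) {f : A →ₗ[R] B}
    {g : B →ₗ[R] D} (hf : Function.Injective f) (hg : Function.Surjective g)
    (hfg : Function.Exact f g) (j k : ℤ) (hjk : k + 1 = j) :
    ∃ δ : (I.homFrom A).homology j →ₗ[R] (I.homFrom D).homology k,
      Function.Exact (I.homologyPrecomp j f) δ ∧ Function.Exact δ (I.homologyPrecomp k g) := by
  obtain ⟨w, hS⟩ := homFromPrecomp_shortExact hI hf hg hfg
  exact ⟨(hS.δ j k hjk).hom,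
    (ShortComplex.ShortExact.moduleCat_exact_iff_function_exact _).1 (hS.homology_exact₃ _ _ _),
    (ShortComplex.ShortExact.moduleCat_exact_iff_function_exact _).1 (hS.homology_exact₁ _ _ _)⟩

lemma subsingleton_homology_homFrom_of_isZero {j : ℤ} (h : IsZero (I.X j)) :
    Subsingleton ((I.homFrom A).homology j) := by
  have : IsZero ((I.homFrom A).X j) := by
    refine @ModuleCat.isZero_of_subsingleton _ _ _ ⟨fun (x y : ModuleCat.of R A ⟶ I.X j) => ?_⟩
    exact h.eq_of_tgt x y
  exact ModuleCat.subsingleton_of_isZero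
    (ShortComplex.isZero_homology_of_isZero_X₂ _ this)

/-- `H_j(Hom_R(-, I))` is invariant under isomorphism. -/
lemma homologyPrecomp_bijective (e : A ≃ₗ[R] B) (j : ℤ) :
    Function.Bijective (I.homologyPrecomp j e.toLinearMap) := by
  have hc : ∀ {X Y : Type u} [AddCommGroup X] [AddCommGroup Y] [Module R X] [Module R Y]
      (e : X ≃ₗ[R] Y) (z), I.homologyPrecomp j e.toLinearMap
        (I.homologyPrecomp j e.symm.toLinearMap z) = z := by
    intro X Y _ _ _ _ e z
    have h : I.homFromPrecomp e.symm.toLinearMap ≫ I.homFromPrecomp e.toLinearMap = 𝟙 _ := by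
      ext i x
      change ModuleCat.ofHom e.toLinearMap ≫ ModuleCat.ofHom e.symm.toLinearMap ≫ x = x
      ext a
      change x.hom (e.symm (e a)) = _
      simp
    have h2 := congrArg
      (fun φ : I.homFrom X ⟶ I.homFrom X => (HomologicalComplex.homologyMap φ j).hom z) h
    simpa [HomologicalComplex.homologyMap_comp, homologyPrecomp] using h2
  exact ⟨Function.LeftInverse.injective (g := I.homologyPrecomp j e.symm.toLinearMap) (hc e.symm),
    Function.RightInverse.surjective (g := I.homologyPrecomp j e.symm.toLinearMap) (hc e)⟩

end ChainComplex

/-! ### Dimension shifting for the vanishing of positive Ext. -/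

section Ext

variable {R : Type u} [CommRing R]
variable {A B D : Type u} [AddCommGroup A] [AddCommGroup B] [AddCommGroup D]
  [Module R A] [Module R B] [Module R D]

/-- `Ext^i_R(A, B) = 0` for all `i > 0`. -/
def ExtPosVanishes (R : Type u) [CommRing R] (A B : Type u) [AddCommGroup A] [AddCommGroup B]
    [Module R A] [Module R B] : Prop :=
  ∀ i : ℕ, 0 < i → Subsingleton (Abelian.Ext (ModuleCat.of R A) (ModuleCat.of R B) i)

lemma shortExact_of_linearMap {f : A →ₗ[R] B} {g : B →ₗ[R] D} (hf : Function.Injective f)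
    (hg : Function.Surjective g) (hfg : Function.Exact f g) :
    (ModuleCat.shortComplexOfCompEqZero f g hfg.linearMap_comp_eq_zero).ShortExact :=
  ModuleCat.shortComplex_shortExact _ hfg hf hg

variable (N : Type u) [AddCommGroup N] [Module R N]

/-- If `Ext^1_R(D, N) = 0`, maps to `N` extend along `A → B` with cokernel `D`. -/
lemma lcomp_surjective_of_ext {f : A →ₗ[R] B} {g : B →ₗ[R] D} (hf : Function.Injective f)
    (hg : Function.Surjective g) (hfg : Function.Exact f g) (h : ExtPosVanishes R D N) :
    Function.Surjective (f.lcomp R N) := by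
  intro x
  have := h 1 one_pos
  obtain ⟨y, hy⟩ := Abelian.Ext.contravariant_sequence_exact₁ (shortExact_of_linearMap hf hg hfg)
    (Y := ModuleCat.of R N) (Abelian.Ext.mk₀ (ModuleCat.ofHom x)) (n₁ := 1) rfl
    (Subsingleton.elim _ _)
  obtain ⟨z, rfl⟩ := (Abelian.Ext.mk₀_bijective _ _).2 y
  rw [Abelian.Ext.mk₀_comp_mk₀] at hy
  exact ⟨z.hom, congrArg ModuleCat.Hom.hom ((Abelian.Ext.mk₀_bijective _ _).1 hy)⟩

lemma ExtPosVanishes.of_shortExact_left {f : A →ₗ[R] B} {g : B →ₗ[R] D}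
    (hf : Function.Injective f) (hg : Function.Surjective g) (hfg : Function.Exact f g)
    (hB : ExtPosVanishes R B N) (hD : ExtPosVanishes R D N) : ExtPosVanishes R A N := by
  intro i hi
  have := hB i hi
  have := hD (1 + i) (by omega)
  refine subsingleton_of_forall_eq 0 fun x => ?_
  obtain ⟨y, hy⟩ := Abelian.Ext.contravariant_sequence_exact₁ (shortExact_of_linearMap hf hg hfg)
    (Y := ModuleCat.of R N) x (n₁ := 1 + i) rfl (Subsingleton.elim _ _)
  rw [← hy, show y = 0 from Subsingleton.elim (α := Abelian.Ext (ModuleCat.of R B) _ i) _ _]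
  simp

lemma ExtPosVanishes.of_projective [Module.Projective R A] : ExtPosVanishes R A N := by
  intro i hi
  obtain ⟨i, rfl⟩ : ∃ k, i = k + 1 := ⟨i - 1, by omega⟩
  have : Projective (ModuleCat.of R A) :=
    (IsProjective.iff_projective A).1 inferInstance
  exact Abelian.Ext.subsingleton_of_projective _ _ _

/-- If `Ext^1_R(N, A) = 0`, maps from `N` lift along `B → D` with kernel `A`. -/
lemma compRight_surjective_of_ext {f : A →ₗ[R] B} {g : B →ₗ[R] D} (hf : Function.Injective f)
    (hg : Function.Surjective g) (hfg : Function.Exact f g) (h : ExtPosVanishes R N A)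
    (x : N →ₗ[R] D) : ∃ y : N →ₗ[R] B, g ∘ₗ y = x := by
  have := h 1 one_pos
  obtain ⟨y, hy⟩ := Abelian.Ext.covariant_sequence_exact₃ (X := ModuleCat.of R N)
    (shortExact_of_linearMap hf hg hfg) (Abelian.Ext.mk₀ (ModuleCat.ofHom x)) (n₁ := 1) rfl
    (Subsingleton.elim (α := Abelian.Ext _ (ModuleCat.of R A) 1) _ _)
  obtain ⟨z, rfl⟩ := (Abelian.Ext.mk₀_bijective _ _).2 y
  rw [Abelian.Ext.mk₀_comp_mk₀] at hy
  exact ⟨z.hom, congrArg ModuleCat.Hom.hom ((Abelian.Ext.mk₀_bijective _ _).1 hy)⟩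

lemma ExtPosVanishes.of_shortExact_right {f : A →ₗ[R] B} {g : B →ₗ[R] D}
    (hf : Function.Injective f) (hg : Function.Surjective g) (hfg : Function.Exact f g)
    (hA : ExtPosVanishes R N A) (hB : ExtPosVanishes R N B) : ExtPosVanishes R N D := by
  intro i hi
  have := hB i hi
  have := hA (i + 1) (by omega)
  refine subsingleton_of_forall_eq 0 fun x => ?_
  obtain ⟨y, hy⟩ := Abelian.Ext.covariant_sequence_exact₃ (X := ModuleCat.of R N)
    (shortExact_of_linearMap hf hg hfg) x (n₁ := i + 1) rfl
    (Subsingleton.elim (α := Abelian.Ext _ (ModuleCat.of R A) (i + 1)) _ _)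
  rw [← hy, show y = 0 from Subsingleton.elim (α := Abelian.Ext _ (ModuleCat.of R B) i) _ _]
  simp

end Ext

/-! ### Finite generation of the homology of `Hom_R(N, I)`. -/

namespace ChainComplex

variable {R : Type u} [CommRing R] {I : ChainComplex (ModuleCat.{u} R) ℤ}
variable {A B D : Type u} [AddCommGroup A] [AddCommGroup B] [AddCommGroup D]
  [Module R A] [Module R B] [Module R D]

lemma isNoetherian_of_exact {X Y Z : Type*} [AddCommGroup X] [AddCommGroup Y] [AddCommGroup Z]
    [Module R X] [Module R Y] [Module R Z] [IsNoetherian R X] [IsNoetherian R Z]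
    {f : X →ₗ[R] Y} {g : Y →ₗ[R] Z} (h : Function.Exact f g) : IsNoetherian R Y :=
  isNoetherian_of_range_eq_ker f g (LinearMap.exact_iff.1 h).symm

variable (I A) in
lemma subsingleton_homology_homFrom_of_subsingleton [Subsingleton A] (j : ℤ) :
    Subsingleton ((I.homFrom A).homology j) := by
  refine subsingleton_of_forall_eq 0 fun z => ?_
  -- On the zero module the endomorphisms 0 and 1 coincide, so they act equally on homology.
  have h : (0 : R) • (LinearMap.id : A →ₗ[R] A) = (1 : R) • LinearMap.id := Subsingleton.elim _ _
  rw [← one_smul R z, ← homologyPrecomp_smul, ← h, homologyPrecomp_smul, zero_smul]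

lemma isNoetherian_homology_pi (hI : ∀ i, Module.Injective R (I.X i)) (j : ℤ)
    [IsNoetherian R ((I.homFrom A).homology j)] (m : ℕ) :
    IsNoetherian R ((I.homFrom (Fin m → A)).homology j) := by
  induction m with
  | zero =>
    have := subsingleton_homology_homFrom_of_subsingleton I (Fin 0 → A) j
    infer_instance
  | succ m ih =>
    refine isNoetherian_of_exact (homologyPrecomp_exact hI
      (f := LinearMap.single R (fun _ : Fin (m + 1) => A) 0)
      (g := LinearMap.funLeft R A Fin.succ) (Pi.single_injective (M := fun _ : Fin (m + 1) => A) 0)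
      (LinearMap.funLeft_surjective_of_injective _ _ _ (Fin.succ_injective m)) ?_ j)
    intro x
    constructor
    · intro hx
      refine ⟨x 0, funext fun k => ?_⟩
      refine Fin.cases (by simp) (fun k => ?_) k
      have := congrFun hx k
      simpa [LinearMap.funLeft_apply] using this.symm
    · rintro ⟨a, rfl⟩
      ext k
      simp [LinearMap.funLeft_apply]

lemma isNoetherian_homology_congr (e : A ≃ₗ[R] B) (j : ℤ)
    [IsNoetherian R ((I.homFrom B).homology j)] : IsNoetherian R ((I.homFrom A).homology j) :=
  isNoetherian_of_surjective _ (LinearMap.range_eq_top.2 (homologyPrecomp_bijective e j).2)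

/-- If `Hom_R(C, I)` has finitely generated homology, so does `Hom_R(Hom_R(X, C), I)` for each
finitely generated `X` with `Ext^i_R(X, C) = 0` for `i > 0`. -/
lemma isNoetherian_homology_dual [IsNoetherianRing R] (hI : ∀ i, Module.Injective R (I.X i))
    {l : ℤ} (hl : ∀ i < l, IsZero (I.X i)) (C : Type u) [AddCommGroup C] [Module R C]
    (hC : ∀ j, IsNoetherian R ((I.homFrom C).homology j)) (j : ℤ) (X : Type u) [AddCommGroup X]
    [Module R X] [Module.Finite R X] (hX : ExtPosVanishes R X C) :
    IsNoetherian R ((I.homFrom (X →ₗ[R] C)).homology j) := by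
  suffices ∀ n : ℕ, ∀ j < l + n, ∀ (X : Type u) [AddCommGroup X] [Module R X] [Module.Finite R X],
      ExtPosVanishes R X C → IsNoetherian R ((I.homFrom (X →ₗ[R] C)).homology j) from
    this (j + 1 - l).toNat j (by omega) X hX
  intro n
  induction n with
  | zero =>
    intro j hj X _ _ _ _
    have := subsingleton_homology_homFrom_of_isZero (A := X →ₗ[R] C) (hl j (by simpa using hj))
    infer_instance
  | succ n ih =>
    intro j hj X _ _ _ hX
    -- Dualize `0 → K → R^m → X → 0` into `C`; since `Ext^1(X, C) = 0`, the result `0 → Hom(X, C) →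
    -- C^m → Hom(K, C) → 0` is exact. Degree `j` for `Hom(X, C)` then sits between degree `j` for
    -- `C^m` and degree `j - 1` for `Hom(K, C)`, and `K` inherits the Ext vanishing.
    obtain ⟨m, π, hπ⟩ := Module.Finite.exists_fin' R X
    have hex : Function.Exact (LinearMap.ker π).subtype π := LinearMap.exact_subtype_ker_map π
    have hK : ExtPosVanishes R (LinearMap.ker π) C :=
      .of_shortExact_left C (Submodule.injective_subtype _) hπ hex (.of_projective C) hX
    have : IsNoetherian R ((I.homFrom ((Fin m → R) →ₗ[R] C)).homology j) := by
      have := isNoetherian_homology_pi (A := C) hI j m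
      exact isNoetherian_homology_congr ((Pi.basisFun R (Fin m)).constr R).symm j
    have := ih (j - 1) (by push_cast at hj; omega) (LinearMap.ker π) hK
    obtain ⟨δ, h1, h2⟩ := exists_connecting hI (f := π.lcomp R C)
      (g := (LinearMap.ker π).subtype.lcomp R C) (LinearMap.lcomp_injective_of_surjective π hπ)
      (lcomp_surjective_of_ext C (Submodule.injective_subtype _) hπ hex hX)
      (LinearMap.exact_lcomp_of_exact_of_surjective C hex hπ) j (j - 1) (sub_add_cancel j 1)
    exact isNoetherian_of_exact h1

/-- If `I` is bounded above and has finitely generated homology, so does `Hom_R(N, I)` for every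
finitely generated module `N`. -/
lemma isNoetherian_homology_homFrom [IsNoetherianRing R] (hI : ∀ i, Module.Injective R (I.X i))
    {b : ℤ} (hb : ∀ i, b < i → IsZero (I.X i))
    (hR : ∀ j, IsNoetherian R ((I.homFrom R).homology j)) (j : ℤ) (N : Type u) [AddCommGroup N]
    [Module R N] [Module.Finite R N] : IsNoetherian R ((I.homFrom N).homology j) := by
  suffices ∀ n : ℕ, ∀ j, b < j + n → ∀ (X : Type u) [AddCommGroup X] [Module R X]
      [Module.Finite R X], IsNoetherian R ((I.homFrom X).homology j) from
    this (b + 1 - j).toNat j (by omega) N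
  intro n
  induction n with
  | zero =>
    intro j hj X _ _ _
    have := subsingleton_homology_homFrom_of_isZero (A := X) (hb j (by simpa using hj))
    infer_instance
  | succ n ih =>
    intro j hj X _ _ _
    -- Here the induction descends from the top of `I`: degree `j` for `X` sits between degree `j +
    -- 1` for the kernel of `π` and degree `j` for `R^m`.
    obtain ⟨m, π, hπ⟩ := Module.Finite.exists_fin' R X
    have := isNoetherian_homology_pi (A := R) hI j m
    have := ih (j + 1) (by push_cast at hj; omega) (LinearMap.ker π)
    obtain ⟨δ, h1, h2⟩ := exists_connecting hI (Submodule.injective_subtype _) hπ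
      (LinearMap.exact_subtype_ker_map π) (j + 1) j rfl
    exact isNoetherian_of_exact h2

/-- If `C` is semidualizing, `I` is a bounded complex of injective modules and `Hom_R(C, I)` has
finitely generated homology, so does `Hom_R(N, I)` for every finitely generated module `N`. -/
lemma isNoetherian_homology_of_isSemidualizing [IsNoetherianRing R]
    (hI : ∀ i, Module.Injective R (I.X i)) (hb : I.IsBounded) {C : Type u} [AddCommGroup C]
    [Module R C] (hC : IsSemidualizing R C)
    (hIC : ∀ j, IsNoetherian R ((I.homFrom C).homology j)) (j : ℤ) (N : Type u) [AddCommGroup N]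
    [Module R N] [Module.Finite R N] : IsNoetherian R ((I.homFrom N).homology j) := by
  obtain ⟨a, b, hab⟩ := hb
  refine isNoetherian_homology_homFrom hI (fun i hi => hab i (.inr hi)) (fun k => ?_) j N
  have := hC.finite
  -- Take `X = C`, so that the dual `Hom(C, C)` is `R`.
  have := isNoetherian_homology_dual hI (fun i hi => hab i (.inl hi)) C hIC k C hC.ext_eq_zero
  exact isNoetherian_homology_congr (LinearEquiv.ofBijective
    (Algebra.linearMap R (Module.End R C)) hC.homothety_bijective) k

end ChainComplex

/-! ### Regular sequences on a semidualizing module. -/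

section RegularSequence

open scoped Pointwise

variable {R : Type u} [CommRing R]

lemma IsSemidualizing.annihilator_eq_bot {C : Type u} [AddCommGroup C] [Module R C]
    (hC : IsSemidualizing R C) : Module.annihilator R C = ⊥ := by
  refine (Submodule.eq_bot_iff _).2 fun r hr => ?_
  refine hC.homothety_bijective.1 (LinearMap.ext fun c => ?_)
  simpa using Module.mem_annihilator.1 hr c

/-- With `K` the kernel of `x` on `N`, regularity of `x` on `Hom(C, N)` gives `Hom(C, K) = 0`. Then
`ann C = 0` contains a `K`-regular element, so 0 is `K`-regular and `K = 0`. -/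
lemma isSMulRegular_linearMap_iff [IsNoetherianRing R] {C N : Type u} [AddCommGroup C]
    [AddCommGroup N] [Module R C] [Module R N] [Module.Finite R C] [Module.Finite R N]
    (hC : Module.annihilator R C = ⊥) (x : R) :
    IsSMulRegular (C →ₗ[R] N) x ↔ IsSMulRegular N x := by
  refine ⟨fun h => ?_, fun h f g hfg => ?_⟩
  · let K := LinearMap.ker (LinearMap.lsmul R N x)
    have hK : Subsingleton (C →ₗ[R] K) := by
      refine subsingleton_of_forall_eq 0 fun f => ?_
      have h0 : K.subtype ∘ₗ f = 0 := by
        refine h (LinearMap.ext fun c => ?_)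
        exact (LinearMap.mem_ker.1 (f c).2).trans (smul_zero x).symm
      ext c
      simpa using LinearMap.congr_fun h0 c
    obtain ⟨r, hr, hreg⟩ := IsSMulRegular.subsingleton_linearMap_iff.1 hK
    rw [hC, Submodule.mem_bot] at hr
    subst hr
    have := IsSMulRegular.zero_iff_subsingleton.1 hreg
    refine isSMulRegular_iff_right_eq_zero_of_smul.2 fun n hn => ?_
    exact congrArg Subtype.val (Subsingleton.elim (⟨n, hn⟩ : K) 0)
  · ext c
    exact h (LinearMap.congr_fun hfg c)

lemma IsSMulRegular.smul_id_injective {N : Type*} [AddCommGroup N] [Module R N] {x : R}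
    (hx : IsSMulRegular N x) : Function.Injective (x • (LinearMap.id : N →ₗ[R] N)) :=
  fun _ _ h => hx h

lemma exact_quotSMulTop {N : Type*} [AddCommGroup N] [Module R N] (x : R) :
    Function.Exact (x • (LinearMap.id : N →ₗ[R] N)) (x • (⊤ : Submodule R N)).mkQ :=
  LinearMap.exact_lsmul_mkQ_smul_top N x

/-- If `Ext^1_R(C, N) = 0` and `x` is `N`-regular, then `Hom(C, N) / x = Hom(C, N / x)`. -/
lemma nonempty_quotSMulTop_linearMap_equiv {C N : Type u} [AddCommGroup C]
    [AddCommGroup N] [Module R C] [Module R N] (h : ExtPosVanishes R C N) {x : R}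
    (hx : IsSMulRegular N x) :
    Nonempty (QuotSMulTop x (C →ₗ[R] N) ≃ₗ[R] (C →ₗ[R] QuotSMulTop x N)) := by
  let φ : (C →ₗ[R] N) →ₗ[R] (C →ₗ[R] QuotSMulTop x N) :=
    LinearMap.llcomp R C N _ (x • (⊤ : Submodule R N)).mkQ
  have hφ : Function.Surjective φ := fun f =>
    compRight_surjective_of_ext C (f := x • LinearMap.id) hx.smul_id_injective
      (Submodule.mkQ_surjective _) (exact_quotSMulTop x) h f
  have hker : x • (⊤ : Submodule R (C →ₗ[R] N)) = LinearMap.ker φ := by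
    ext f
    rw [Submodule.mem_smul_pointwise_iff_exists, LinearMap.mem_ker]
    constructor
    · rintro ⟨g, -, rfl⟩
      ext c
      exact (exact_quotSMulTop x (x • g c)).2 ⟨g c, rfl⟩
    · intro hf
      have hmem : ∀ c, ∃ n, x • n = f c := fun c =>
        (exact_quotSMulTop x (f c)).1 (LinearMap.congr_fun hf c)
      choose g hg using hmem
      -- Division by `x` is unique because `x` is `N`-regular, so the pointwise quotient `g` is
      -- linear.
      refine ⟨⟨⟨g, fun a b => hx ?_⟩, fun r a => hx ?_⟩, trivial, LinearMap.ext hg⟩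
      · simp only [smul_add, hg, map_add]
      · simp only [RingHom.id_apply, smul_comm x r, hg, map_smul]
  exact ⟨(Submodule.quotEquivOfEq _ _ hker).trans (φ.quotKerEquivOfSurjective hφ)⟩

open RingTheory.Sequence in
-- Vanishing of `Ext(C, N)` in positive degrees passes to `N/xN`, and it gives `Hom(C, N)/x = Hom(C,
-- N/xN)`; so the sequence can be treated one element at a time.
lemma isWeaklyRegular_linearMap_iff [IsNoetherianRing R] {C : Type u} [AddCommGroup C]
    [Module R C] [Module.Finite R C] (hC : Module.annihilator R C = ⊥) (rs : List R) :
    ∀ (N : Type u) [AddCommGroup N] [Module R N] [Module.Finite R N], ExtPosVanishes R C N →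
      (IsWeaklyRegular (C →ₗ[R] N) rs ↔ IsWeaklyRegular N rs) := by
  induction rs with
  | nil => exact fun N _ _ _ _ => ⟨fun _ => .nil R N, fun _ => .nil R _⟩
  | cons x rs ih =>
    intro N _ _ _ hN
    rw [isWeaklyRegular_cons_iff, isWeaklyRegular_cons_iff, isSMulRegular_linearMap_iff hC]
    refine and_congr_right fun hx => ?_
    obtain ⟨e⟩ := nonempty_quotSMulTop_linearMap_equiv hN hx
    rw [e.isWeaklyRegular_congr rs]
    exact ih _ (.of_shortExact_right C (f := x • LinearMap.id) hx.smul_id_injective (Submodule.mkQ_surjective _)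
      (exact_quotSMulTop x) hN hN)

open RingTheory.Sequence in
/-- Over a semidualizing module, the weakly regular sequences are those of the ring. -/
lemma IsSemidualizing.isWeaklyRegular_iff [IsNoetherianRing R] {C : Type u} [AddCommGroup C]
    [Module R C] (hC : IsSemidualizing R C) (rs : List R) :
    IsWeaklyRegular C rs ↔ IsWeaklyRegular R rs := by
  have := hC.finite
  rw [← isWeaklyRegular_linearMap_iff hC.annihilator_eq_bot rs C hC.ext_eq_zero]
  exact (LinearEquiv.ofBijective
    (Algebra.linearMap R (Module.End R C)) hC.homothety_bijective).symm.isWeaklyRegular_congr rs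

end RegularSequence

/-! ### Bass's argument: regular elements, Nakayama's lemma and prime filtrations. -/

namespace ChainComplex

open IsLocalRing RingTheory.Sequence
open scoped Pointwise

variable {R : Type u} [CommRing R] {I : ChainComplex (ModuleCat.{u} R) ℤ}
variable {A B D : Type u} [AddCommGroup A] [AddCommGroup B] [AddCommGroup D]
  [Module R A] [Module R B] [Module R D]

lemma subsingleton_of_exact {X Y Z : Type*} [AddCommGroup X] [AddCommGroup Y] [AddCommGroup Z]
    [Module R X] [Module R Y] [Module R Z] [Subsingleton X] [Subsingleton Z]
    {f : X →ₗ[R] Y} {g : Y →ₗ[R] Z} (h : Function.Exact f g) : Subsingleton Y := by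
  refine subsingleton_of_forall_eq 0 fun y => ?_
  obtain ⟨x, rfl⟩ := (h y).1 (Subsingleton.elim _ _)
  rw [Subsingleton.elim x 0, map_zero]

lemma subsingleton_of_smul_surjective [IsLocalRing R] {X : Type*} [AddCommGroup X] [Module R X]
    [IsNoetherian R X] {x : R} (hx : x ∈ maximalIdeal R)
    (h : ∀ z : X, ∃ y, x • y = z) : Subsingleton X := by
  by_contra hX
  rw [not_subsingleton_iff_nontrivial] at hX
  have := nontrivial_quotSMulTop_of_mem_maximalIdeal X hx
  obtain ⟨z, hz⟩ := exists_ne (0 : QuotSMulTop x X)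
  obtain ⟨z, rfl⟩ := Submodule.mkQ_surjective _ z
  obtain ⟨y, rfl⟩ := h z
  exact hz ((exact_quotSMulTop x (x • y)).2 ⟨y, rfl⟩)

variable [IsLocalRing R] (hI : ∀ i, Module.Injective R (I.X i))
include hI

/-- Killing an `A`-regular element lowers the least degree of nonzero homology of `Hom_R(A, I)`
by one. -/
lemma homology_quotSMulTop {x : R} (hx : x ∈ maximalIdeal R) (hA : IsSMulRegular A x) {s : ℤ}
    (hfin : IsNoetherian R ((I.homFrom A).homology s))
    (h0 : ∀ i < s, Subsingleton ((I.homFrom A).homology i))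
    (h1 : Nontrivial ((I.homFrom A).homology s)) :
    (∀ i < s - 1, Subsingleton ((I.homFrom (QuotSMulTop x A)).homology i)) ∧
      Nontrivial ((I.homFrom (QuotSMulTop x A)).homology (s - 1)) := by
  constructor
  · intro i hi
    obtain ⟨δ, h2, h3⟩ := exists_connecting hI (f := x • LinearMap.id) hA.smul_id_injective
      (Submodule.mkQ_surjective _) (exact_quotSMulTop x) (i + 1) i rfl
    have := h0 (i + 1) (by omega)
    have := h0 i (by omega)
    exact subsingleton_of_exact h3
  · obtain ⟨δ, h2, h3⟩ := exists_connecting hI (f := x • LinearMap.id) hA.smul_id_injective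
      (Submodule.mkQ_surjective _) (exact_quotSMulTop x) s (s - 1) (by omega)
    -- If degree `s - 1` vanished for `A/xA`, multiplication by `x` would be surjective on the
    -- nonzero finitely generated module in degree `s`.
    by_contra hne
    rw [not_nontrivial_iff_subsingleton] at hne
    refine not_subsingleton _ (subsingleton_of_smul_surjective
      (X := (I.homFrom A).homology s) hx fun z => ?_)
    obtain ⟨y, rfl⟩ := (h2 z).1 (@Subsingleton.elim _ hne _ _)
    exact ⟨y, (homologyPrecomp_smul I s x y).symm⟩

lemma homology_quotient_ofList (rs : List R) (hfin : ∀ (j : ℤ) (A : Type u) [AddCommGroup A]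
      [Module R A] [Module.Finite R A], IsNoetherian R ((I.homFrom A).homology j)) :
    ∀ (A : Type u) [AddCommGroup A] [Module R A] [Module.Finite R A] (s : ℤ),
    (∀ r ∈ rs, r ∈ maximalIdeal R) → IsWeaklyRegular A rs →
    (∀ i < s, Subsingleton ((I.homFrom A).homology i)) →
    Nontrivial ((I.homFrom A).homology s) →
    (∀ i < s - rs.length, Subsingleton
      ((I.homFrom (A ⧸ (Ideal.ofList rs • ⊤ : Submodule R A))).homology i)) ∧
      Nontrivial
        ((I.homFrom (A ⧸ (Ideal.ofList rs • ⊤ : Submodule R A))).homology (s - rs.length)) := by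
  induction rs with
  | nil =>
    intro A _ _ _ s _ _ h0 h1
    have e : (A ⧸ (Ideal.ofList ([] : List R) • ⊤ : Submodule R A)) ≃ₗ[R] A :=
      Submodule.quotEquivOfEqBot _ (by simp)
    refine ⟨fun i hi => ?_, ?_⟩
    · have := h0 i (by simpa using hi)
      exact (homologyPrecomp_bijective (I := I) e i).2.subsingleton
    · have := (homologyPrecomp_bijective (I := I) e s).1.nontrivial
      simpa using this
  | cons x rs ih =>
    intro A _ _ _ s hmem hreg h0 h1
    rw [isWeaklyRegular_cons_iff] at hreg
    obtain ⟨h2, h3⟩ := homology_quotSMulTop hI (hmem x (by simp)) hreg.1 (hfin s A) h0 h1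
    obtain ⟨h4, h5⟩ := ih (QuotSMulTop x A) (s - 1) (fun r hr => hmem r (by simp [hr])) hreg.2
      h2 h3
    have e := Submodule.quotOfListConsSMulTopEquivQuotSMulTopInner A x rs
    have hs : s - ((x :: rs).length : ℤ) = s - 1 - rs.length := by
      simp; ring
    rw [hs]
    refine ⟨fun i hi => ?_, ?_⟩
    · have := h4 i hi
      exact (homologyPrecomp_bijective (I := I) e i).2.subsingleton
    · exact (homologyPrecomp_bijective (I := I) e _).1.nontrivial

/-- If `k` embeds in `N`, the vanishing of `H_i(Hom_R(N, I))` for all `i < d` forces the vanishing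
of `H_i(Hom_R(A, I))` for all finitely generated `A` and all `i < d`. -/
lemma subsingleton_homology_of_depth_zero [IsNoetherianRing R] {l : ℤ}
    (hl : ∀ i < l, IsZero (I.X i))
    (hfin : ∀ (j : ℤ) (A : Type u) [AddCommGroup A] [Module R A] [Module.Finite R A],
      IsNoetherian R ((I.homFrom A).homology j))
    (N : Type u) [AddCommGroup N] [Module R N] [Module.Finite R N]
    (f : (R ⧸ maximalIdeal R) →ₗ[R] N) (hf : Function.Injective f) {d : ℤ}
    (hN : ∀ i < d, Subsingleton ((I.homFrom N).homology i)) (i : ℤ) (hi : i < d)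
    (A : Type u) [AddCommGroup A] [Module R A] [Module.Finite R A] :
    Subsingleton ((I.homFrom A).homology i) := by
  suffices ∀ n : ℕ, ∀ i < l + n, i < d → ∀ (A : Type u) [AddCommGroup A] [Module R A]
      [Module.Finite R A], Subsingleton ((I.homFrom A).homology i) from
    this (i + 1 - l).toNat i (by omega) hi A
  intro n
  induction n with
  | zero =>
    intro i hi _ A _ _ _
    exact subsingleton_homology_homFrom_of_isZero (hl i (by simpa using hi))
  | succ n ih =>
    intro i hi hid A _ _ hA
    replace ih := ih (i - 1) (by push_cast at hi; omega) (by omega)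
    -- Degree `i` for the residue field sits between degree `i` for `N`, zero by hypothesis, and
    -- degree `i - 1` for the cokernel of `f`, zero by induction.
    have hk : Subsingleton ((I.homFrom (R ⧸ maximalIdeal R)).homology i) := by
      obtain ⟨δ, h1, h2⟩ := exists_connecting hI hf (Submodule.mkQ_surjective (LinearMap.range f))
        (LinearMap.exact_map_mkQ_range f) i (i - 1) (by omega)
      have := hN i hid
      have := ih (N ⧸ LinearMap.range f)
      exact subsingleton_of_exact h1
    -- For `p` not maximal, some `x` in the maximal ideal is regular on `R/p`; by induction the
    -- obstruction in degree `i - 1` is zero, so `x` acts surjectively and Nakayama's lemma applies.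
    -- A prime filtration then handles general `A`.
    have hprime : ∀ p : Ideal R, p.IsPrime → Subsingleton ((I.homFrom (R ⧸ p)).homology i) := by
      intro p hp
      by_cases hpm : p = maximalIdeal R
      · rw [hpm]; exact hk
      · obtain ⟨x, hxm, hxp⟩ : ∃ x ∈ maximalIdeal R, x ∉ p := by
          by_contra! h
          exact hpm (le_antisymm (le_maximalIdeal hp.ne_top) h)
        have hreg : IsSMulRegular (R ⧸ p) x := by
          refine isSMulRegular_iff_right_eq_zero_of_smul.2 fun z hz => ?_
          rw [Algebra.smul_def, mul_eq_zero] at hz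
          exact hz.resolve_left fun h => hxp (Ideal.Quotient.eq_zero_iff_mem.1 h)
        obtain ⟨δ, h1, h2⟩ := exists_connecting hI (f := x • LinearMap.id) hreg.smul_id_injective
          (Submodule.mkQ_surjective _) (exact_quotSMulTop x) i (i - 1) (by omega)
        have := ih (QuotSMulTop x (R ⧸ p))
        have := hfin i (R ⧸ p)
        refine subsingleton_of_smul_surjective hxm fun z => ?_
        obtain ⟨y, rfl⟩ := (h1 z).1 (Subsingleton.elim _ _)
        exact ⟨y, (homologyPrecomp_smul I i x y).symm⟩
    refine IsNoetherianRing.induction_on_isQuotientEquivQuotientPrime R hA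
      (motive := fun A _ _ _ => Subsingleton ((I.homFrom A).homology i)) ?_ ?_ ?_
    · intro X _ _ _ _
      exact subsingleton_homology_homFrom_of_subsingleton I X i
    · intro X _ _ _ p e
      have := hprime p.1 p.2
      exact (homologyPrecomp_bijective (I := I) e i).2.subsingleton
    · intro X _ _ _ Y _ _ _ Z _ _ _ f g hf hg hfg hX hZ
      exact subsingleton_of_exact (homologyPrecomp_exact hI hf hg hfg i)

end ChainComplex

/-! ### Truncation of a complex of injective modules. -/

/-- The hypotheses match cycles with cycles and boundaries with boundaries. They are weaker than
isomorphism in each degree because a truncation keeps only the cycles in its lowest degree. -/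
lemma CategoryTheory.ShortComplex.nonempty_homology_linearEquiv {R : Type u} [CommRing R]
    {S₁ S₂ : ShortComplex (ModuleCat.{u} R)} (φ : S₁ ⟶ S₂) (h₁ : Function.Surjective φ.τ₁)
    (h₂ : Function.Injective φ.τ₂) (h₃ : Function.Injective φ.τ₃)
    (h : ∀ x : S₂.X₂, S₂.g x = 0 → ∃ y, φ.τ₂ y = x) :
    Nonempty (S₁.homology ≃ₗ[R] S₂.homology) := by
  have hg : ∀ x, S₂.g (φ.τ₂ x) = φ.τ₃ (S₁.g x) := fun x =>
    congrArg (fun ψ => ψ.hom x) φ.comm₂₃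
  have hf : ∀ x, S₂.f (φ.τ₁ x) = φ.τ₂ (S₁.f x) := fun x =>
    congrArg (fun ψ => ψ.hom x) φ.comm₁₂
  let κ : LinearMap.ker S₁.g.hom →ₗ[R] LinearMap.ker S₂.g.hom :=
    φ.τ₂.hom.restrict fun x (hx : S₁.g x = 0) => (hg x).trans (by rw [hx, map_zero])
  have hκ : Function.Bijective κ := by
    constructor
    · intro x y hxy
      exact Subtype.ext (h₂ (congrArg Subtype.val hxy))
    · rintro ⟨x, hx⟩
      obtain ⟨y, rfl⟩ := h x hx
      exact ⟨⟨y, h₃ ((hg y).symm.trans (hx.trans (map_zero _).symm))⟩, rfl⟩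
  let e := LinearEquiv.ofBijective κ hκ
  have he : (LinearMap.range S₁.moduleCatToCycles).map e.toLinearMap =
      LinearMap.range S₂.moduleCatToCycles := by
    ext z
    constructor
    · rintro ⟨_, ⟨x, rfl⟩, rfl⟩
      exact ⟨φ.τ₁ x, Subtype.ext (hf x)⟩
    · rintro ⟨x, rfl⟩
      obtain ⟨x, rfl⟩ := h₁ x
      exact ⟨_, ⟨x, rfl⟩, Subtype.ext (hf x).symm⟩
  exact ⟨S₁.moduleCatHomologyIso.toLinearEquiv.trans ((Submodule.Quotient.equiv _ _ e he).trans
    S₂.moduleCatHomologyIso.toLinearEquiv.symm)⟩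

namespace ChainComplex

variable {R : Type u} [CommRing R] (I : ChainComplex (ModuleCat.{u} R) ℤ) (d : ℤ)

/-- The components of the canonical truncation of `I`: everything above degree `d`, the cycles in
degree `d`, and zero below. -/
def truncationSubmodule (i : ℤ) : Submodule R (I.X i) :=
  -- An infimum over a false proposition is `⊤`, so each condition is active only in its own range
  -- of degrees.
  (⨅ _ : i < d, ⊥) ⊓ ⨅ _ : i ≤ d, LinearMap.ker (I.d i (i - 1)).hom

lemma mem_truncationSubmodule {i : ℤ} {x : I.X i} :
    x ∈ I.truncationSubmodule d i ↔ (i < d → x = 0) ∧ (i ≤ d → I.d i (i - 1) x = 0) := by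
  simp [truncationSubmodule]

lemma d_mem_truncationSubmodule (i j : ℤ) (x : I.X i) (hx : x ∈ I.truncationSubmodule d i) :
    (I.d i j).hom x ∈ I.truncationSubmodule d j := by
  rw [mem_truncationSubmodule] at hx ⊢
  have h2 : I.d j (j - 1) (I.d i j x) = 0 :=
    congrArg (fun ψ => ψ.hom x) (I.d_comp_d i j (j - 1))
  refine ⟨fun hj => ?_, fun _ => h2⟩
  by_cases hij : j + 1 = i
  · obtain rfl : j = i - 1 := by omega
    exact hx.2 (by omega)
  · rw [I.shape i j hij]; rfl

/-- The canonical truncation of `I`, as a subcomplex: `I_i` for `i > d`, the cycles in degree `d`,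
and zero below. -/
def truncation : ChainComplex (ModuleCat.{u} R) ℤ where
  X i := ModuleCat.of R (I.truncationSubmodule d i)
  d i j := ModuleCat.ofHom ((I.d i j).hom.restrict (I.d_mem_truncationSubmodule d i j))
  shape i j hij := by
    refine ModuleCat.hom_ext (LinearMap.ext fun x => Subtype.ext ?_)
    exact congrArg (fun ψ => ψ.hom x.1) (I.shape i j hij)
  d_comp_d' i j k _ _ := by
    refine ModuleCat.hom_ext (LinearMap.ext fun x => Subtype.ext ?_)
    exact congrArg (fun ψ => ψ.hom x.1) (I.d_comp_d i j k)

/-- The inclusion of the truncation. -/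
def truncationι : I.truncation d ⟶ I where
  f i := ModuleCat.ofHom (I.truncationSubmodule d i).subtype
  comm' _ _ _ := rfl

lemma isZero_truncation_X {i : ℤ} (hi : i < d) : IsZero ((I.truncation d).X i) := by
  refine @ModuleCat.isZero_of_subsingleton _ _ _ ⟨fun x y => Subtype.ext ?_⟩
  rw [((I.mem_truncationSubmodule d).1 x.2).1 hi, ((I.mem_truncationSubmodule d).1 y.2).1 hi]

lemma truncationSubmodule_eq_top {i : ℤ} (hi : d < i) : I.truncationSubmodule d i = ⊤ := by
  refine Submodule.eq_top_iff'.2 fun x => (I.mem_truncationSubmodule d).2 ?_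
  exact ⟨fun h => by omega, fun h => by omega⟩

/-- The critical case is `j = d`: a cycle of `Hom_R(C, I)` in degree `d` is a map with image in the
cycles of `I`, so it factors through the truncation. -/
lemma nonempty_homology_truncation_equiv (C : Type u) [AddCommGroup C] [Module R C] {j : ℤ}
    (hj : d ≤ j) :
    Nonempty (((I.truncation d).homFrom C).homology j ≃ₗ[R] (I.homFrom C).homology j) := by
  let φ : (I.truncation d).homFrom C ⟶ I.homFrom C :=
    (((linearCoyoneda R (ModuleCat.{u} R)).obj
      (Opposite.op (ModuleCat.of R C))).mapHomologicalComplex (ComplexShape.down ℤ)).map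
        (I.truncationι d)
  have hinj : ∀ i, Function.Injective (φ.f i) := by
    intro i (f : ModuleCat.of R C ⟶ (I.truncation d).X i)
      (g : ModuleCat.of R C ⟶ (I.truncation d).X i)
      (h : f ≫ (I.truncationι d).f i = g ≫ (I.truncationι d).f i)
    refine ModuleCat.hom_ext (LinearMap.ext fun c => Subtype.ext ?_)
    exact congrArg (fun ψ => ψ.hom c) h
  have hp : (ComplexShape.down ℤ).prev j = j + 1 := ChainComplex.prev ℤ j
  have hn : (ComplexShape.down ℤ).next j = j - 1 := ChainComplex.next ℤ j
  obtain ⟨e⟩ := ShortComplex.nonempty_homology_linearEquiv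
    ((HomologicalComplex.shortComplexFunctor' (ModuleCat.{u} R) (ComplexShape.down ℤ)
      (j + 1) j (j - 1)).map φ) (by
      intro (f : ModuleCat.of R C ⟶ I.X (j + 1))
      refine ⟨ModuleCat.ofHom (f.hom.codRestrict (I.truncationSubmodule d (j + 1)) fun c => ?_),
        rfl⟩
      rw [I.truncationSubmodule_eq_top d (by omega)]
      trivial) (hinj j) (hinj (j - 1)) (by
      intro (f : ModuleCat.of R C ⟶ I.X j) (hf : f ≫ I.d j (j - 1) = 0)
      refine ⟨ModuleCat.ofHom (f.hom.codRestrict (I.truncationSubmodule d j) fun c => ?_), rfl⟩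
      exact (I.mem_truncationSubmodule d).2 ⟨fun h => by omega, fun _ =>
        congrArg (fun ψ => ψ.hom c) hf⟩)
  exact ⟨(HomologicalComplex.homologyIsoSc' _ _ _ _ hp hn).toLinearEquiv.trans (e.trans
    (HomologicalComplex.homologyIsoSc' _ _ _ _ hp hn).toLinearEquiv.symm)⟩

variable {I}

/-- If `H_{d-1}(Hom_R(R/a, I)) = 0` for all ideals `a`, the cycles of `I` in degree `d` form an
injective module. -/
lemma injective_truncation_X (hI : ∀ i, Module.Injective R (I.X i))
    (h : ∀ a : Ideal R, Subsingleton ((I.homFrom (R ⧸ a)).homology (d - 1))) (i : ℤ) :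
    Module.Injective R ((I.truncation d).X i) := by
  refine Module.Baer.injective ?_
  rcases lt_trichotomy i d with hi | rfl | hi
  · intro a g
    have := ModuleCat.subsingleton_of_isZero (I.isZero_truncation_X d hi)
    exact ⟨0, fun _ _ => Subsingleton.elim _ _⟩
  · intro a (g : a →ₗ[R] I.truncationSubmodule i i)
    -- Baer's criterion: extend `g` to `e : R → I_i`. Then `d ∘ e` kills `a` and induces a cycle `y`
    -- in `Hom_R(R/a, I_{i-1})`. By hypothesis `y` is the boundary of some `z`, and subtracting `z`
    -- from `e` gives an extension with values in the cycles.
    obtain ⟨e, he⟩ := Module.Baer.of_injective (hI i) a ((Submodule.subtype _) ∘ₗ g)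
    have hcyc : ∀ z : I.truncationSubmodule i i, (I.d i (i - 1)).hom z.1 = 0 := fun z =>
      ((I.mem_truncationSubmodule i).1 z.2).2 le_rfl
    have hex := (HomologicalComplex.exactAt_iff' (I.homFrom (R ⧸ a)) i (i - 1) (i - 1 - 1)
      ((ChainComplex.prev ℤ _).trans (by simp)) (ChainComplex.next ℤ _)).1
      ((HomologicalComplex.exactAt_iff_isZero_homology _ _).2
        (@ModuleCat.isZero_of_subsingleton _ _ _ (h a)))
    rw [ShortComplex.moduleCat_exact_iff] at hex
    have hle : a ≤ LinearMap.ker ((I.d i (i - 1)).hom ∘ₗ e) := fun x hx => by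
      rw [LinearMap.mem_ker, LinearMap.comp_apply, he x hx]
      exact hcyc _
    let y : ModuleCat.of R (R ⧸ a) ⟶ I.X (i - 1) :=
      ModuleCat.ofHom (Submodule.liftQ a ((I.d i (i - 1)).hom ∘ₗ e) hle)
    obtain ⟨(z : ModuleCat.of R (R ⧸ a) ⟶ I.X i), (hz : z ≫ I.d i (i - 1) = y)⟩ := hex y (by
      change y ≫ I.d (i - 1) (i - 1 - 1) = 0
      refine ModuleCat.hom_ext (LinearMap.ext fun r => ?_)
      obtain ⟨r, rfl⟩ := Submodule.mkQ_surjective a r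
      exact congrArg (fun ψ => ψ.hom (e r)) (I.d_comp_d i (i - 1) (i - 1 - 1)))
    refine ⟨(e - z.hom ∘ₗ a.mkQ).codRestrict (I.truncationSubmodule i i) fun r => ?_,
      fun r hr => Subtype.ext ?_⟩
    · refine (I.mem_truncationSubmodule i).2 ⟨fun h => absurd h (lt_irrefl i), fun _ => ?_⟩
      have hzr := congrArg (fun ψ => ψ.hom (a.mkQ r)) hz
      change (I.d i (i - 1)).hom (e r - z.hom (a.mkQ r)) = 0
      rw [map_sub, sub_eq_zero]
      exact hzr.symm
    · change e r - z.hom (a.mkQ r) = (g ⟨r, hr⟩).1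
      rw [he r hr, show a.mkQ r = 0 from (Submodule.Quotient.mk_eq_zero a).2 hr, map_zero,
        sub_zero]
      rfl
  · have e : I.X i ≃ₗ[R] (I.truncation d).X i :=
      (LinearEquiv.ofTop _ (I.truncationSubmodule_eq_top d hi)).symm
    exact Module.Baer.of_equiv e (Module.Baer.of_injective (hI i))

end ChainComplex

/-! ### Least degrees of nonzero homology and of nonzero terms. -/

namespace ChainComplex

variable {R : Type u} [CommRing R]

lemma homologicalInf_eq {X : ChainComplex (ModuleCat.{u} R) ℤ} {s : ℤ}
    (hs : ¬ IsZero (X.homology s)) (h : ∀ i < s, IsZero (X.homology i)) :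
    X.homologicalInf = ((s : ℝ) : EReal) := by
  refine le_antisymm (iInf₂_le s hs) (le_iInf₂ fun i hi => ?_)
  have : s ≤ i := not_lt.1 fun hlt => hi (h i hlt)
  exact_mod_cast this

lemma exists_least_homology {X : ChainComplex (ModuleCat.{u} R) ℤ} (hX : ¬ X.Acyclic) {l : ℤ}
    (hl : ∀ i < l, Subsingleton (X.homology i)) :
    ∃ s : ℤ, Nontrivial (X.homology s) ∧ ∀ i < s, Subsingleton (X.homology i) := by
  obtain ⟨s, hs, hmin⟩ := Int.exists_least_of_bdd (P := fun i => Nontrivial (X.homology i))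
    ⟨l, fun i hi => not_lt.1 fun h => not_subsingleton_iff_nontrivial.2 hi (hl i h)⟩ (by
      by_contra! h
      exact hX fun i => (HomologicalComplex.exactAt_iff_isZero_homology _ _).2
        (ModuleCat.isZero_iff_subsingleton.2 (h i)))
  exact ⟨s, hs, fun i hi => not_nontrivial_iff_subsingleton.1 fun h =>
    absurd (hmin i h) (not_le.2 hi)⟩

/-- `Hom_R(C, E)` vanishes for an injective `E` only if `E` does. -/
lemma isZero_of_isZero_homFrom {I : ChainComplex (ModuleCat.{u} R) ℤ} {i : ℤ}
    (hI : Module.Injective R (I.X i)) {C : Type u} [AddCommGroup C] [Module R C]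
    (hC : IsSemidualizing R C) (h : IsZero ((I.homFrom C).X i)) : IsZero (I.X i) := by
  refine @ModuleCat.isZero_of_subsingleton _ _ _ (subsingleton_of_forall_eq 0 fun m => ?_)
  have := hC.finite
  -- Generators of the faithful module `C` embed `R` in `C^n`; by injectivity the map `1 ↦ m`
  -- extends to `C^n`, from which every map is zero.
  obtain ⟨n, c, hc⟩ := Module.Finite.exists_fin (R := R) (M := C)
  let f : R →ₗ[R] (Fin n → C) := LinearMap.toSpanSingleton R _ c
  have hf : Function.Injective f := by
    refine (injective_iff_map_eq_zero f).2 fun r hr => ?_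
    have hrC : r ∈ Module.annihilator R C := by
      rw [← Submodule.annihilator_top, ← hc, Submodule.mem_annihilator_span]
      rintro ⟨_, k, rfl⟩
      exact congrFun hr k
    rwa [hC.annihilator_eq_bot] at hrC
  obtain ⟨g, hg⟩ := hI.out f hf (LinearMap.toSpanSingleton R _ m)
  have hg0 : g = 0 := by
    refine LinearMap.pi_ext' fun k => ?_
    have hsub : Subsingleton (ModuleCat.of R C ⟶ I.X i) := ModuleCat.subsingleton_of_isZero h
    exact congrArg ModuleCat.Hom.hom
      (hsub.elim (ModuleCat.ofHom (g ∘ₗ LinearMap.single R (fun _ : Fin n => C) k)) 0)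
  have := hg 1
  rw [hg0] at this
  simpa using this.symm

end ChainComplex

/-! ### Depth and maximal regular sequences. -/

section Depth

open IsLocalRing RingTheory.Sequence

variable {R : Type u} [CommRing R] [IsLocalRing R]

/-- If the lengths of the regular sequences are bounded, the depth is attained. -/
lemma exists_localRingDepth_eq {n : ℕ} (h : ∀ rs : List R, (∀ r ∈ rs, r ∈ maximalIdeal R) →
    IsRegular R rs → rs.length ≤ n) :
    ∃ rs : List R, (∀ r ∈ rs, r ∈ maximalIdeal R) ∧ IsRegular R rs ∧
      localRingDepth R = rs.length ∧
      ∀ rs' : List R, (∀ r ∈ rs', r ∈ maximalIdeal R) → IsRegular R rs' →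
        rs'.length ≤ rs.length := by
  let S : Set ℕ := {k | ∃ rs : List R, ((∀ r ∈ rs, r ∈ maximalIdeal R) ∧ IsRegular R rs) ∧
    rs.length = k}
  have hbdd : BddAbove S := ⟨n, by rintro _ ⟨rs, h1, rfl⟩; exact h rs h1.1 h1.2⟩
  have hne : S.Nonempty := ⟨0, [], ⟨by simp, .nil R R⟩, rfl⟩
  obtain ⟨rs, h1, h2⟩ := Nat.sSup_mem hne hbdd
  have hmax : ∀ rs' : List R, (∀ r ∈ rs', r ∈ maximalIdeal R) → IsRegular R rs' →
      rs'.length ≤ rs.length := fun rs' h3 h4 => h2 ▸ le_csSup hbdd ⟨rs', ⟨h3, h4⟩, rfl⟩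
  refine ⟨rs, h1.1, h1.2, le_antisymm (iSup₂_le fun rs' h3 => ?_) ?_, hmax⟩
  · exact_mod_cast hmax rs' h3.1 h3.2
  · exact le_iSup₂_of_le rs h1 le_rfl

/-- The quotient of a semidualizing module by a maximal regular sequence contains the residue
field. -/
lemma exists_injective_residueField [IsNoetherianRing R] {C : Type u} [AddCommGroup C]
    [Module R C] (hC : IsSemidualizing R C) {rs : List R} (hmem : ∀ r ∈ rs, r ∈ maximalIdeal R)
    (hreg : IsRegular R rs) (hmax : ∀ rs' : List R, (∀ r ∈ rs', r ∈ maximalIdeal R) →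
      IsRegular R rs' → rs'.length ≤ rs.length) :
    ∃ f : (R ⧸ maximalIdeal R) →ₗ[R] (C ⧸ (Ideal.ofList rs • ⊤ : Submodule R C)),
      Function.Injective f := by
  have := hC.finite
  -- If there were no nonzero map, the maximal ideal would contain an element regular on the
  -- quotient of `C`. Appending it to `rs` would give a longer regular sequence on `C`, hence on
  -- `R`.
  have hn : ¬ Subsingleton
      ((R ⧸ maximalIdeal R) →ₗ[R] (C ⧸ (Ideal.ofList rs • ⊤ : Submodule R C))) := by
    intro h
    obtain ⟨r, hr, hr'⟩ := IsSMulRegular.subsingleton_linearMap_iff.1 h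
    rw [Ideal.annihilator_quotient] at hr
    have h1 : IsWeaklyRegular R (rs ++ [r]) := by
      rw [← hC.isWeaklyRegular_iff, isWeaklyRegular_append_iff, isWeaklyRegular_singleton_iff]
      exact ⟨(hC.isWeaklyRegular_iff rs).2 hreg.toIsWeaklyRegular, hr'⟩
    have h2 : ∀ x ∈ rs ++ [r], x ∈ maximalIdeal R := by
      intro x hx
      rcases List.mem_append.1 hx with hx | hx
      · exact hmem x hx
      · rwa [List.mem_singleton.1 hx]
    have := hmax _ h2 (.of_isWeaklyRegular_of_mem_maximalIdeal R h2 h1)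
    simp at this
  rw [not_subsingleton_iff_nontrivial] at hn
  obtain ⟨f, hf⟩ := exists_ne (0 : (R ⧸ maximalIdeal R) →ₗ[R]
    (C ⧸ (Ideal.ofList rs • ⊤ : Submodule R C)))
  -- A nonzero map out of the residue field is injective: a nonzero class in the kernel is
  -- represented by a unit and would force `f = 0`.
  refine ⟨f, (injective_iff_map_eq_zero f).2 fun x hx => ?_⟩
  by_contra hx0
  obtain ⟨a, rfl⟩ := Ideal.Quotient.mk_surjective x
  have ha : IsUnit a := by
    by_contra ha
    exact hx0 (Ideal.Quotient.eq_zero_iff_mem.2 ((mem_maximalIdeal a).2 ha))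
  refine hf (LinearMap.ext fun y => ?_)
  obtain ⟨b, rfl⟩ := Ideal.Quotient.mk_surjective y
  obtain ⟨c, hc⟩ := ha.exists_left_inv
  have : Ideal.Quotient.mk (maximalIdeal R) b = (b * c) • Ideal.Quotient.mk (maximalIdeal R) a := by
    rw [Algebra.smul_def, Ideal.Quotient.algebraMap_eq, ← map_mul, mul_assoc, hc, mul_one]
  rw [this, map_smul, hx, smul_zero, LinearMap.zero_apply]

end Depth

/-! ### The two inequalities and the theorem. -/

section Resolution

open IsLocalRing RingTheory.Sequence ChainComplex

variable {R : Type u} [CommRing R] [IsNoetherianRing R] [IsLocalRing R]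
  {C M : Type u} [AddCommGroup C] [Module R C] [AddCommGroup M] [Module R M] [Module.Finite R M]
  {I : ChainComplex (ModuleCat.{u} R) ℤ}

omit [IsLocalRing R] in
lemma IsCQuasiInjectiveResolution.isNoetherian_homology (hI : IsCQuasiInjectiveResolution C M I)
    (hC : IsSemidualizing R C) (j : ℤ) (N : Type u) [AddCommGroup N] [Module R N]
    [Module.Finite R N] : IsNoetherian R ((I.homFrom N).homology j) := by
  refine isNoetherian_homology_of_isSemidualizing hI.injective hI.isBounded hC (fun i => ?_) j N
  obtain ⟨b, ⟨e⟩⟩ := hI.homology_iso i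
  exact isNoetherian_of_linearEquiv e.symm

omit [IsNoetherianRing R] [IsLocalRing R] [Module.Finite R M] in
lemma IsCQuasiInjectiveResolution.exists_least (hI : IsCQuasiInjectiveResolution C M I) :
    ∃ s : ℤ, Nontrivial ((I.homFrom C).homology s) ∧
      (∀ i < s, Subsingleton ((I.homFrom C).homology i)) ∧
      (I.homFrom C).homologicalInf = ((s : ℝ) : EReal) := by
  obtain ⟨a, b, hab⟩ := hI.isBounded
  obtain ⟨s, h1, h2⟩ := exists_least_homology hI.not_acyclic
    fun i hi => subsingleton_homology_homFrom_of_isZero (hab i (.inl hi))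
  exact ⟨s, h1, h2, homologicalInf_eq
    (fun h => not_subsingleton_iff_nontrivial.2 h1 (ModuleCat.subsingleton_of_isZero h))
    fun i hi => ModuleCat.isZero_iff_subsingleton.2 (h2 i hi)⟩

/-- A regular sequence of length `n` forces `I_{s - n} ≠ 0`, where `s = hinf Hom_R(C, I)`. -/
lemma IsCQuasiInjectiveResolution.not_isZero (hI : IsCQuasiInjectiveResolution C M I)
    (hC : IsSemidualizing R C) {s : ℤ} (h1 : Nontrivial ((I.homFrom C).homology s))
    (h2 : ∀ i < s, Subsingleton ((I.homFrom C).homology i)) {rs : List R}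
    (hmem : ∀ r ∈ rs, r ∈ maximalIdeal R) (hreg : IsRegular R rs) :
    ¬ IsZero (I.X (s - rs.length)) := by
  intro h
  have := hC.finite
  have h3 := (homology_quotient_ofList hI.injective rs
    (fun j A _ _ _ => hI.isNoetherian_homology hC j A) C s hmem
    ((hC.isWeaklyRegular_iff rs).2 hreg.toIsWeaklyRegular) h2 h1).2
  exact not_subsingleton_iff_nontrivial.2 h3 (subsingleton_homology_homFrom_of_isZero h)

lemma IsCQuasiInjectiveResolution.length_le (hI : IsCQuasiInjectiveResolution C M I)
    (hC : IsSemidualizing R C) {rs : List R}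
    (hmem : ∀ r ∈ rs, r ∈ maximalIdeal R) (hreg : IsRegular R rs) :
    ((rs.length : ℝ) : EReal) ≤ (I.homFrom C).homologicalInf - (I.homFrom C).lowerInf := by
  obtain ⟨s, h1, h2, h3⟩ := hI.exists_least
  have h4 : (I.homFrom C).lowerInf ≤ (((s - rs.length : ℤ) : ℝ) : EReal) :=
    iInf₂_le _ fun h => hI.not_isZero hC h1 h2 hmem hreg
      (isZero_of_isZero_homFrom (hI.injective _) hC h)
  calc ((rs.length : ℝ) : EReal) = ((s : ℝ) : EReal) - (((s - rs.length : ℤ) : ℝ) : EReal) := by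
        rw [← EReal.coe_sub, EReal.coe_eq_coe_iff]; push_cast; ring
    _ ≤ _ := h3 ▸ EReal.sub_le_sub le_rfl h4

/-- Boundedness of `I` below limits how far a regular sequence can push down from `s`; this is where
finiteness of the depth comes from. -/
lemma IsCQuasiInjectiveResolution.exists_length_bound (hI : IsCQuasiInjectiveResolution C M I)
    (hC : IsSemidualizing R C) :
    ∃ n : ℕ, ∀ rs : List R, (∀ r ∈ rs, r ∈ maximalIdeal R) → IsRegular R rs → rs.length ≤ n := by
  obtain ⟨s, h1, h2, h3⟩ := hI.exists_least
  obtain ⟨a, b, hab⟩ := hI.isBounded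
  refine ⟨(s - a).toNat, fun rs hmem hreg => ?_⟩
  have : ¬ (s - rs.length < a) := fun h =>
    hI.not_isZero hC h1 h2 hmem hreg (hab _ (.inl h))
  omega

/-- Truncating at `hinf Hom_R(C, I) - depth R` yields a resolution realizing the depth. -/
lemma IsCQuasiInjectiveResolution.exists_le (hI : IsCQuasiInjectiveResolution C M I)
    (hC : IsSemidualizing R C) {rs : List R} (hmem : ∀ r ∈ rs, r ∈ maximalIdeal R)
    (hreg : IsRegular R rs) (hmax : ∀ rs' : List R, (∀ r ∈ rs', r ∈ maximalIdeal R) →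
      IsRegular R rs' → rs'.length ≤ rs.length) :
    ∃ I' : ChainComplex (ModuleCat.{u} R) ℤ, IsCQuasiInjectiveResolution C M I' ∧
      (I'.homFrom C).homologicalInf - (I'.homFrom C).lowerInf ≤ ((rs.length : ℝ) : EReal) := by
  have := hC.finite
  obtain ⟨s, h1, h2, -⟩ := hI.exists_least
  obtain ⟨a, b, hab⟩ := hI.isBounded
  set d : ℤ := s - rs.length with hd
  have hfin := fun j (A : Type u) [AddCommGroup A] [Module R A] [Module.Finite R A] =>
    hI.isNoetherian_homology hC j A
  obtain ⟨f, hf⟩ := exists_injective_residueField hC hmem hreg hmax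
  have hvan := subsingleton_homology_of_depth_zero hI.injective (fun i hi => hab i (.inl hi)) hfin
    _ f hf (homology_quotient_ofList hI.injective rs hfin C s hmem
    ((hC.isWeaklyRegular_iff rs).2 hreg.toIsWeaklyRegular) h2 h1).1
  -- From degree `d` upward truncation preserves homology; below `d` both sides vanish, the
  -- right-hand one by `hvan`.
  have hiso : ∀ j, Nonempty
      (((I.truncation d).homFrom C).homology j ≃ₗ[R] (I.homFrom C).homology j) := by
    intro j
    by_cases hj : d ≤ j
    · exact I.nonempty_homology_truncation_equiv d C hj
    · have := hvan j (not_le.1 hj) C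
      have := subsingleton_homology_homFrom_of_isZero (A := C)
        (I.isZero_truncation_X d (not_le.1 hj))
      exact ⟨LinearEquiv.ofSubsingleton _ _⟩
  have hs : Nontrivial (((I.truncation d).homFrom C).homology s) := by
    obtain ⟨e⟩ := hiso s
    exact e.toEquiv.nontrivial
  have hlow : ∀ i < s, Subsingleton (((I.truncation d).homFrom C).homology i) := by
    intro i hi
    obtain ⟨e⟩ := hiso i
    have := h2 i hi
    exact e.toEquiv.subsingleton
  have hs' : ¬ IsZero (((I.truncation d).homFrom C).homology s) := fun h =>
    not_subsingleton_iff_nontrivial.2 hs (ModuleCat.subsingleton_of_isZero h)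
  refine ⟨I.truncation d, ⟨?_, ?_, ?_, ?_⟩, ?_⟩
  · refine ⟨d, b, fun i hi => ?_⟩
    rcases hi with hi | hi
    · exact I.isZero_truncation_X d hi
    · have := ModuleCat.subsingleton_of_isZero (hab i (.inr hi))
      exact @ModuleCat.isZero_of_subsingleton _ _ _
        (inferInstanceAs (Subsingleton (I.truncationSubmodule d i)))
  · exact injective_truncation_X d hI.injective fun a => hvan (d - 1) (by omega) (R ⧸ a)
  · exact fun h => hs' ((HomologicalComplex.exactAt_iff_isZero_homology _ _).1 (h s))
  · intro i
    obtain ⟨e⟩ := hiso i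
    obtain ⟨b, ⟨e'⟩⟩ := hI.homology_iso i
    exact ⟨b, ⟨e.trans e'⟩⟩
  · rw [homologicalInf_eq hs' fun i hi => ModuleCat.isZero_iff_subsingleton.2 (hlow i hi)]
    -- Only `d ≤ inf` is needed, as the difference `s - inf` is to be bounded above by `s - d`.
    have hlower : ((d : ℝ) : EReal) ≤ ((I.truncation d).homFrom C).lowerInf := by
      refine le_iInf₂ fun i hi => ?_
      have : d ≤ i := not_lt.1 fun hlt => hi
        (@ModuleCat.isZero_of_subsingleton _ _ _ ⟨fun
          (x y : ModuleCat.of R C ⟶ (I.truncation d).X i) =>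
            (I.isZero_truncation_X d hlt).eq_of_tgt x y⟩)
      exact_mod_cast this
    calc _ ≤ ((s : ℝ) : EReal) - ((d : ℝ) : EReal) := EReal.sub_le_sub le_rfl hlower
      _ = _ := by rw [← EReal.coe_sub, hd, EReal.coe_eq_coe_iff]; push_cast; ring

end Resolution

/-- A nonzero finitely generated module of finite `C`-quasi-injective dimension has
`C`-quasi-injective dimension `depth R`. The argument does not need the alternative `h`:
since `I = C ⊗ Hom_R(C, I)` for a bounded complex `I` of injective modules, `I` has finitely
generated homology as soon as `Hom_R(C, I)` does, and Bass's argument applies to `I`. -/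
theorem mainTheorem2 (R : Type u) [CommRing R] [IsNoetherianRing R] [IsLocalRing R]
    (C : Type u) [AddCommGroup C] [Module R C] (hC : IsSemidualizing R C)
    (M : Type u) [AddCommGroup M] [Module R M] [Module.Finite R M] [Nontrivial M]
    (hM : cQuasiInjectiveDim R C M < ⊤)
    (h : IsCohenMacaulayLocalRing R ∨ TorPosVanishes R C M) :
    cQuasiInjectiveDim R C M = ((localRingDepth R : ℝ≥0∞) : EReal) := by
  have hdim : cQuasiInjectiveDim R C M =
      ⨅ (I : ChainComplex (ModuleCat.{u} R) ℤ) (_ : IsCQuasiInjectiveResolution C M I),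
        (I.homFrom C).homologicalInf - (I.homFrom C).lowerInf :=
    if_neg (not_subsingleton M)
  rw [hdim] at hM ⊢
  -- An infimum below `⊤` provides an actual resolution, which bounds the lengths of regular
  -- sequences and is the one to truncate.
  obtain ⟨I, hI⟩ := iInf_lt_iff.1 hM
  obtain ⟨hI, -⟩ := iInf_lt_iff.1 hI
  obtain ⟨n, hn⟩ := hI.exists_length_bound hC
  obtain ⟨rs, hmem, hreg, hdepth, hmax⟩ := exists_localRingDepth_eq hn
  have hcast : ((localRingDepth R : ℝ≥0∞) : EReal) = ((rs.length : ℝ) : EReal) := by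
    rw [hdepth, ENat.toENNReal_coe, ← ENNReal.ofReal_natCast,
      EReal.coe_ennreal_ofReal, max_eq_left (Nat.cast_nonneg _)]
  rw [hcast]
  refine le_antisymm ?_ (le_iInf₂ fun J hJ => hJ.length_le hC hmem hreg)
  obtain ⟨I', hI', hle⟩ := hI.exists_le hC hmem hreg hmax
  exact (iInf₂_le I' hI').trans hle
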